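/- The \emph{one-dimensional fragment} $F_1[\mathrm{succ}_1,\mathrm{succ}_2]$ is the set of first-order formulas over the signature consisting of countably many unary relation symbols and two binary relation symbols $\mathrm{succ}_1,\mathrm{succ}_2$ that is defined inductively as follows: it contains all atoms over this signature and all equalities $x=y$ between variables; it is closed under $\vee$ and $\neg$; and if $\varphi$ belongs to it and has exactly the free variables $x_0,\dots,x_k$ (listed in any order), then $\exists x_0\cdots x_k\,\varphi$ and $\exists x_1\cdots x_k\,\varphi$ belong to it. Formulas are interpreted over structures with a nonempty domain that carry two strict linear orders $<_1,<_2$, where $\mathrm{succ}_i$ is interpreted as the successor relation induced by $<_i$ (that is, $\mathrm{succ}_i(a,b)$ iff $a<_i b$ and there is no $c$ with $a<_i c<_i b$), the unary symbols are interpreted arbitrarily, and the orders are not accessible otherwise. \textbf{Theorem.} The satisfiability problem for $F_1[\mathrm{succ}_1,\mathrm{succ}_2]$, i.e. the question whether a given sentence of $F_1[\mathrm{succ}_1,\mathrm{succ}_2]$ has a model, is undecidable. This holds for each of the following three classes of admissible models: the finite structures with two linear orders; the structures with two linear orders each of which is isomorphic to $(\mathbb N,<)$; and all structures with two linear orders.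 -/

import Mathlib

namespace OneDim

/-- First-order formulas with equality over the signature consisting of unary relation symbols
`P₀, P₁, P₂, …` and two binary relation symbols `succ₁`, `succ₂`. Variables are named by natural
numbers, and existential quantification comes in blocks:
`ex [x₁, …, xₖ] φ` is `∃ x₁, …, xₖ φ`. -/
inductive Formula : Type
  | pred (i x : ℕ) : Formula
  | succ₁ (x y : ℕ) : Formula
  | succ₂ (x y : ℕ) : Formula
  | eq (x y : ℕ) : Formula
  | or (φ ψ : Formula) : Formula
  | neg (φ : Formula) : Formula
  | ex (xs : List ℕ) (φ : Formula) : Formula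

namespace Formula

/-- The set of free variables. -/
def free : Formula → Finset ℕ
  | pred _ x => {x}
  | succ₁ x y => {x, y}
  | succ₂ x y => {x, y}
  | eq x y => {x, y}
  | or φ ψ => φ.free ∪ ψ.free
  | neg φ => φ.free
  | ex xs φ => φ.free \ xs.toFinset

/-- A sentence is a formula without free variables. -/
def IsSentence (φ : Formula) : Prop := φ.free = ∅

/-- The one-dimensional fragment: a block of existential quantifiers binds all free variables of
the quantified formula, or all but one of them. -/
inductive IsF1 : Formula → Prop
  | pred (i x : ℕ) : IsF1 (pred i x)
  | succ₁ (x y : ℕ) : IsF1 (succ₁ x y)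
  | succ₂ (x y : ℕ) : IsF1 (succ₂ x y)
  | eq (x y : ℕ) : IsF1 (eq x y)
  | or {φ ψ : Formula} : IsF1 φ → IsF1 ψ → IsF1 (or φ ψ)
  | neg {φ : Formula} : IsF1 φ → IsF1 (neg φ)
  | ex_all {φ : Formula} {xs : List ℕ} : IsF1 φ → xs ≠ [] → xs.Nodup →
      xs.toFinset = φ.free → IsF1 (ex xs φ)
  | ex_all_but_one {φ : Formula} {x : ℕ} {xs : List ℕ} : IsF1 φ → xs ≠ [] → xs.Nodup →
      x ∈ φ.free → xs.toFinset = φ.free.erase x → IsF1 (ex xs φ)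

/-! ### Gödel numbering

Formulas are the inputs of a decision procedure, so they are numbered effectively, in a bijective
way: the remainder mod `7` is the outermost constructor, and the quotient codes its arguments. -/

/-- The number of a formula. -/
def toNat : Formula → ℕ
  | pred i x => 7 * Nat.pair i x
  | succ₁ x y => 7 * Nat.pair x y + 1
  | succ₂ x y => 7 * Nat.pair x y + 2
  | eq x y => 7 * Nat.pair x y + 3
  | or φ ψ => 7 * Nat.pair φ.toNat ψ.toNat + 4
  | neg φ => 7 * φ.toNat + 5
  | ex xs φ => 7 * Nat.pair (Encodable.encode xs) φ.toNat + 6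

/-- The formula with a given number. -/
def ofNat (n : ℕ) : Formula :=
  if n % 7 = 0 then pred (n / 7).unpair.1 (n / 7).unpair.2
  else if n % 7 = 1 then succ₁ (n / 7).unpair.1 (n / 7).unpair.2
  else if n % 7 = 2 then succ₂ (n / 7).unpair.1 (n / 7).unpair.2
  else if n % 7 = 3 then eq (n / 7).unpair.1 (n / 7).unpair.2
  else if _h : n % 7 = 4 then or (ofNat (n / 7).unpair.1) (ofNat (n / 7).unpair.2)
  else if _h : n % 7 = 5 then neg (ofNat (n / 7))
  else if _h : n % 7 = 6 then
    ex (Denumerable.ofNat (List ℕ) (n / 7).unpair.1) (ofNat (n / 7).unpair.2)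
  else pred 0 0
termination_by n
decreasing_by
  · have := Nat.unpair_left_le (n / 7); omega
  · have := Nat.unpair_right_le (n / 7); omega
  · omega
  · have := Nat.unpair_right_le (n / 7); omega

theorem ofNat_toNat (φ : Formula) : ofNat φ.toNat = φ := by
  induction φ with
  | pred i x => rw [toNat, ofNat]; simp
  | succ₁ x y =>
    rw [toNat, ofNat]
    have h : (7 * Nat.pair x y + 1) / 7 = Nat.pair x y := by omega
    simp [h, Nat.add_mod]
  | succ₂ x y =>
    rw [toNat, ofNat]
    have h : (7 * Nat.pair x y + 2) / 7 = Nat.pair x y := by omega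
    simp [h, Nat.add_mod]
  | eq x y =>
    rw [toNat, ofNat]
    have h : (7 * Nat.pair x y + 3) / 7 = Nat.pair x y := by omega
    simp [h, Nat.add_mod]
  | or φ ψ ih₁ ih₂ =>
    rw [toNat, ofNat]
    have h : (7 * Nat.pair φ.toNat ψ.toNat + 4) / 7 = Nat.pair φ.toNat ψ.toNat := by omega
    simp [h, Nat.add_mod, ih₁, ih₂]
  | neg φ ih =>
    rw [toNat, ofNat]
    have h : (7 * φ.toNat + 5) / 7 = φ.toNat := by omega
    simp [h, Nat.add_mod, ih]
  | ex xs φ ih =>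
    rw [toNat, ofNat]
    have h : (7 * Nat.pair (Encodable.encode xs) φ.toNat + 6) / 7 =
      Nat.pair (Encodable.encode xs) φ.toNat := by omega
    simp [h, Nat.add_mod, ih]

theorem toNat_ofNat (n : ℕ) : (ofNat n).toNat = n := by
  induction n using Nat.strong_induction_on with
  | _ n ih =>
    have h₁ := Nat.unpair_left_le (n / 7)
    have h₂ := Nat.unpair_right_le (n / 7)
    rw [ofNat]
    split_ifs with a₀ a₁ a₂ a₃ a₄ a₅ a₆
    · simp only [toNat, Nat.pair_unpair]; omega
    · simp only [toNat, Nat.pair_unpair]; omega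
    · simp only [toNat, Nat.pair_unpair]; omega
    · simp only [toNat, Nat.pair_unpair]; omega
    · rw [toNat, ih _ (by omega), ih _ (by omega), Nat.pair_unpair]; omega
    · rw [toNat, ih _ (by omega)]; omega
    · rw [toNat, ih _ (by omega), Denumerable.encode_ofNat, Nat.pair_unpair]; omega
    · omega

/-- The Gödel numbering as a bijection. -/
def equivNat : Formula ≃ ℕ := ⟨toNat, ofNat, ofNat_toNat, toNat_ofNat⟩

instance : Denumerable Formula := Denumerable.mk' equivNat

end Formula

/-- A structure with domain `M` that carries two strict linear orders and interprets the unary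
relation symbols. -/
structure BiorderedStructure (M : Type) where
  lt₁ : M → M → Prop
  lt₂ : M → M → Prop
  linear₁ : IsStrictTotalOrder M lt₁
  linear₂ : IsStrictTotalOrder M lt₂
  P : ℕ → M → Prop

/-- The successor relation induced by a strict order. -/
def InducedSucc {M : Type} (lt : M → M → Prop) (a b : M) : Prop :=
  lt a b ∧ ¬ ∃ c, lt a c ∧ lt c b

/-- Truth of a formula in a structure under an assignment `v` of the variables. The orders are
accessible through their successor relations only. -/
def Formula.Holds {M : Type} (A : BiorderedStructure M) : Formula → (ℕ → M) → Prop
  | .pred i x, v => A.P i (v x)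
  | .succ₁ x y, v => InducedSucc A.lt₁ (v x) (v y)
  | .succ₂ x y, v => InducedSucc A.lt₂ (v x) (v y)
  | .eq x y, v => v x = v y
  | .or φ ψ, v => φ.Holds A v ∨ ψ.Holds A v
  | .neg φ, v => ¬ φ.Holds A v
  | .ex xs φ, v => ∃ w : ℕ → M, (∀ x, x ∉ xs → w x = v x) ∧ φ.Holds A w

/-- A class of structures with two linear orders. -/
abbrev StructureClass := ∀ M : Type, BiorderedStructure M → Prop

/-- All structures with two linear orders. -/
def allStructures : StructureClass := fun _ _ => True

/-- The finite structures with two linear orders. -/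
def finiteStructures : StructureClass := fun M _ => Finite M

/-- The structures in which both orders are isomorphic to `(ℕ, <)`. -/
def omegaStructures : StructureClass := fun _ A =>
  Nonempty (A.lt₁ ≃r ((· < ·) : ℕ → ℕ → Prop)) ∧
  Nonempty (A.lt₂ ≃r ((· < ·) : ℕ → ℕ → Prop))

/-- `φ` has a model in the class `K`. (The existence of an assignment `v` makes the domain
nonempty.) -/
def SatisfiableOver (K : StructureClass) (φ : Formula) : Prop :=
  ∃ (M : Type) (A : BiorderedStructure M), K M A ∧ ∃ v : ℕ → M, φ.Holds A v

/-- The satisfiability problem for the one-dimensional fragment with two successor relations over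
the class `K` is decidable: some algorithm gives, on every sentence of the fragment, the correct
answer to the question whether it has a model in `K`. -/
def F1SatDecidable (K : StructureClass) : Prop :=
  ∃ D : Formula → Prop, ComputablePred D ∧
    ∀ φ : Formula, φ.IsF1 → φ.IsSentence → (D φ ↔ SatisfiableOver K φ)

end OneDim

/-! The halting problem of a queue machine is reduced to satisfiability. In each step the machine
removes one letter and appends two. Writing all letters in the order in which they enter the queue
gives one word. If the input has length `k`, step `i` reads position `i` and writes positions `k + 2
* i` and `k + 2 * i + 1`. The first order carries this word. The second order only has to connect
position `i` to position `k + 2 * i`, and that connection can be propagated locally: when the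
reading place advances by one letter, the writing place advances by two. A rule of this kind is a
universal block over all its variables, followed where needed by an existential block that leaves
one variable free, so it lies in the fragment.

Each position occupies two elements, a letter and a reader, and `succ₂` leads from readers to
letters. The links demanded of the second order are therefore disjoint pairs. Linking the letters
directly would produce infinite chains `i, k + 2 * i, …`, several of which do not fit into an order
of type `ℕ`.

In any model of the rules the computation unfolds along the first order (`at_step`, `at_run`). If
stopping is not forbidden, a finite model exists iff the machine halts: an endless run needs
infinitely many elements, and a halting run can be cut off. If stopping is forbidden, a model exists
iff the machine does not halt, and then there is one in which both orders have type `ℕ`. This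
settles the other two classes together.

Queue machines are universal because they simulate the multi-stack machines `TM2`, which compute all
partial recursive functions (`respects`). The program number `n` is supplied as the input `2 ^ n`,
in binary a block of `n` zeros and a one, so the sentence depends on `n` only through an iterated
prefix. -/

namespace OneDim

/-! ### Derived connectives. -/

namespace Formula

/-- Conjunction. -/
def and (φ ψ : Formula) : Formula := neg (or (neg φ) (neg ψ))

/-- Implication. -/
def imp (φ ψ : Formula) : Formula := or (neg φ) ψ

/-- A block of universal quantifiers. -/
def all (xs : List ℕ) (φ : Formula) : Formula := neg (ex xs (neg φ))

/-- The conjunction of a list of sentences. -/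
def conj : List Formula → Formula
  | [] => all [0] (eq 0 0)
  | φ :: l => and φ (conj l)

theorem free_and (φ ψ : Formula) : (and φ ψ).free = φ.free ∪ ψ.free := rfl

theorem free_imp (φ ψ : Formula) : (imp φ ψ).free = φ.free ∪ ψ.free := rfl

theorem free_conj : ∀ l : List Formula, (∀ φ ∈ l, φ.free = ∅) → (conj l).free = ∅
  | [], _ => rfl
  | φ :: l, h => by
    rw [conj, free_and, h φ (by simp), free_conj l fun ψ hψ => h ψ (by simp [hψ])]
    rfl

theorem IsF1.and {φ ψ : Formula} (hφ : IsF1 φ) (hψ : IsF1 ψ) : IsF1 (φ.and ψ) :=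
  (hφ.neg.or hψ.neg).neg

theorem IsF1.imp {φ ψ : Formula} (hφ : IsF1 φ) (hψ : IsF1 ψ) : IsF1 (φ.imp ψ) :=
  hφ.neg.or hψ

theorem IsF1.all {φ : Formula} {xs : List ℕ} (hφ : IsF1 φ) (h₀ : xs ≠ []) (h₁ : xs.Nodup)
    (h : xs.toFinset = φ.free) : IsF1 (φ.all xs) :=
  (IsF1.ex_all hφ.neg h₀ h₁ h).neg

theorem IsF1.conj : ∀ l : List Formula, (∀ φ ∈ l, IsF1 φ) → IsF1 (conj l)
  | [], _ => (IsF1.eq 0 0).all (by simp) (by simp) rfl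
  | φ :: l, h => (h φ (by simp)).and (IsF1.conj l fun ψ hψ => h ψ (by simp [hψ]))

variable {M : Type} {A : BiorderedStructure M} {v : ℕ → M}

theorem holds_and {φ ψ : Formula} : (and φ ψ).Holds A v ↔ φ.Holds A v ∧ ψ.Holds A v := by
  simp only [and, Holds]; tauto

theorem holds_imp {φ ψ : Formula} : (imp φ ψ).Holds A v ↔ (φ.Holds A v → ψ.Holds A v) := by
  simp only [imp, Holds]; tauto

theorem holds_all {φ : Formula} {xs : List ℕ} :
    (all xs φ).Holds A v ↔ ∀ w : ℕ → M, (∀ x, x ∉ xs → w x = v x) → φ.Holds A w := by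
  simp only [all, Holds, not_exists, not_and, not_not]

theorem holds_conj {l : List Formula} : (conj l).Holds A v ↔ ∀ φ ∈ l, φ.Holds A v := by
  induction l with
  | nil => simp [conj, holds_all, Holds]
  | cons φ l ih => simp [conj, holds_and, ih]

end Formula

/-! ### Sentences that describe a computation, and their membership in the fragment. -/

open Formula

/-- Reading the word `w` of predicate indices from `x`, every second element in the first order
being a letter, one arrives at `z`. -/
def Path {M : Type} (A : BiorderedStructure M) : M → List ℕ → M → Prop
  | x, [], z => x = z
  | x, a :: w, z =>
    A.P a x ∧ ∃ t y, InducedSucc A.lt₁ x t ∧ InducedSucc A.lt₁ t y ∧ Path A y w z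

/-- The word `w` can be read from the element `x₀` up to an element that satisfies `P₁`. -/
def chain : List ℕ → Formula
  | [] => .pred 1 0
  | a :: w => and (.pred a 0)
      (.ex [1, 2] (and (.succ₁ 0 1) (and (.succ₁ 1 2) (.ex [0] (and (.eq 0 2) (chain w))))))

/-- From an element that satisfies `P₀` the word `w` can be read. -/
def initRule (w : List ℕ) : Formula := .ex [0] (and (.pred 0 0) (chain w))

/-- The elements that satisfy `P₀` satisfy `s`. -/
def stateRule (s : ℕ) : Formula := all [0] (imp (.pred 0 0) (.pred s 0))

/-- The reader following an element that satisfies `P₀` is matched with the elements that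
satisfy `P₁`. -/
def matchRule : Formula :=
  all [0, 1, 2] (imp (and (.pred 0 0) (and (.succ₁ 0 1) (.pred 1 2))) (.succ₂ 1 2))

/-- If `a` is read in state `s`, then the letters `b` and `c` are written. -/
def writeRule (s a b c : ℕ) : Formula :=
  all [0] (imp (and (.pred s 0) (.pred a 0)) (.ex [1, 2, 3, 4, 5, 6]
    (and (.succ₁ 0 1) (and (.succ₂ 1 2) (and (.pred b 2) (and (.succ₁ 2 3) (and (.succ₁ 3 4)
      (and (.pred c 4) (and (.succ₁ 4 5) (.succ₁ 5 6))))))))))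

/-- If `a` is read in state `s`, then the next letter is read in state `s'`, and the position at
which the output is written advances by two letters. -/
def moveRule (s a s' : ℕ) : Formula :=
  all [0, 1, 2, 3, 4, 5, 6, 7, 8] (imp
    (and (.pred s 0) (and (.pred a 0) (and (.succ₁ 0 1) (and (.succ₁ 1 2) (and (.succ₁ 2 3)
      (and (.succ₂ 1 4) (and (.succ₁ 4 5) (and (.succ₁ 5 6)
        (and (.succ₁ 6 7) (.succ₁ 7 8))))))))))
    (and (.pred s' 2) (.succ₂ 3 8)))

/-- The letter `a` is never read in state `s`. -/
def forbidRule (s a : ℕ) : Formula := all [0] (imp (.pred s 0) (.neg (.pred a 0)))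

theorem free_chain (w : List ℕ) : (chain w).free = {0} := by
  induction w with
  | nil => rfl
  | cons a w ih => simp only [chain, free_and, free, ih]; rfl

/-- Each block leaves exactly one variable free. The equality of the variables `0` and `2` passes
the current element on under the name `0`, so the rest of the word can be described with the same
three variables. -/
theorem isF1_chain (w : List ℕ) : IsF1 (chain w) := by
  induction w with
  | nil => exact .pred 1 0
  | cons a w ih =>
    refine (IsF1.pred a 0).and (.ex_all_but_one (x := 0) ((IsF1.succ₁ 0 1).and
      ((IsF1.succ₁ 1 2).and (.ex_all_but_one (x := 2) ((IsF1.eq 0 2).and ih)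
        (by simp) (by simp) ?_ ?_))) (by simp) (by simp) ?_ ?_)
    all_goals simp only [free_and, free, free_chain]; decide

theorem isF1_initRule (w : List ℕ) : IsF1 (initRule w) :=
  .ex_all ((IsF1.pred 0 0).and (isF1_chain w)) (by simp) (by simp)
    (by simp only [free_and, free, free_chain]; rfl)

theorem free_initRule (w : List ℕ) : (initRule w).free = ∅ := by
  simp only [initRule, free_and, free, free_chain]; rfl

theorem isF1_stateRule (s : ℕ) : IsF1 (stateRule s) :=
  ((IsF1.pred 0 0).imp (.pred s 0)).all (by simp) (by simp) rfl

/-- A block that binds everything is allowed even though no premise connects variable `2` to the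
others. This ties the first reader to the end of an input of arbitrary length. -/
theorem isF1_matchRule : IsF1 matchRule :=
  (((IsF1.pred 0 0).and ((IsF1.succ₁ 0 1).and (.pred 1 2))).imp (.succ₂ 1 2)).all
    (by simp) (by simp) rfl

theorem isF1_writeRule (s a b c : ℕ) : IsF1 (writeRule s a b c) :=
  (((IsF1.pred s 0).and (.pred a 0)).imp (.ex_all_but_one (x := 0)
    ((IsF1.succ₁ 0 1).and ((IsF1.succ₂ 1 2).and ((IsF1.pred b 2).and ((IsF1.succ₁ 2 3).and
      ((IsF1.succ₁ 3 4).and ((IsF1.pred c 4).and ((IsF1.succ₁ 4 5).and (.succ₁ 5 6))))))))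
    (by simp) (by simp) (by simp [free_and, free]) rfl)).all (by simp) (by simp) rfl

theorem isF1_moveRule (s a s' : ℕ) : IsF1 (moveRule s a s') :=
  (((IsF1.pred s 0).and ((IsF1.pred a 0).and ((IsF1.succ₁ 0 1).and ((IsF1.succ₁ 1 2).and
    ((IsF1.succ₁ 2 3).and ((IsF1.succ₂ 1 4).and ((IsF1.succ₁ 4 5).and ((IsF1.succ₁ 5 6).and
      ((IsF1.succ₁ 6 7).and (.succ₁ 7 8)))))))))).imp ((IsF1.pred s' 2).and (.succ₂ 3 8))).all
    (by simp) (by simp) (by simp only [free_and, free_imp, free]; decide)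

theorem isF1_forbidRule (s a : ℕ) : IsF1 (forbidRule s a) :=
  ((IsF1.pred s 0).imp (IsF1.pred a 0).neg).all (by simp) (by simp) rfl

/-! ### Meaning of the rules in a structure. -/

section Semantics

variable {M : Type} {A : BiorderedStructure M} {v : ℕ → M}

theorem holds_chain {w : List ℕ} :
    (chain w).Holds A v ↔ ∃ z, Path A (v 0) w z ∧ A.P 1 z := by
  induction w generalizing v with
  | nil => simp [chain, Path, Holds]
  | cons a w ih =>
    simp only [chain, holds_and, Holds, ih, Path]
    constructor
    · rintro ⟨ha, u, hu, h₁, h₂, u', hu', h, z, hz, hz'⟩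
      rw [hu 0 (by simp)] at h₁
      rw [h, hu' 2 (by simp)] at hz
      exact ⟨z, ⟨ha, u 1, u 2, h₁, h₂, hz⟩, hz'⟩
    · rintro ⟨z, ⟨ha, t, y, h₁, h₂, hz⟩, hz'⟩
      -- The assignment takes listed values on the first variables and defaults to `v` beyond the
      -- list.
      refine ⟨ha, fun n => [v 0, t, y].getD n (v n), ?_, h₁, h₂,
        fun n => [y, t, y].getD n (v n), ?_, rfl, z, hz, hz'⟩
      · rintro (_ | _ | _ | x) hx <;> simp_all
      · rintro (_ | _ | _ | x) hx <;> simp_all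

theorem holds_initRule {w : List ℕ} :
    (initRule w).Holds A v ↔ ∃ x z, A.P 0 x ∧ Path A x w z ∧ A.P 1 z := by
  simp only [initRule, holds_and, Holds, holds_chain]
  constructor
  · rintro ⟨u, -, h₁, z, h₂, h₃⟩
    exact ⟨_, z, h₁, h₂, h₃⟩
  · rintro ⟨x, z, h₁, h₂, h₃⟩
    refine ⟨fun n => [x].getD n (v n), ?_, h₁, z, h₂, h₃⟩
    rintro (_ | x) hx <;> simp_all

theorem holds_stateRule {s : ℕ} : (stateRule s).Holds A v ↔ ∀ x, A.P 0 x → A.P s x := by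
  simp only [stateRule, holds_all, holds_imp, Holds]
  constructor
  · intro h x
    refine h (fun n => [x].getD n (v n)) ?_
    rintro (_ | x) hx <;> simp_all
  · intro h w _
    exact h _

theorem holds_matchRule : matchRule.Holds A v ↔
    ∀ x t z, A.P 0 x → InducedSucc A.lt₁ x t → A.P 1 z → InducedSucc A.lt₂ t z := by
  simp only [matchRule, holds_all, holds_imp, holds_and, Holds]
  constructor
  · intro h x t z h₀ h₁ h₂
    refine h (fun n => [x, t, z].getD n (v n)) ?_ ⟨h₀, h₁, h₂⟩
    rintro (_ | _ | _ | x) hx <;> simp_all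
  · intro h w _ hw
    exact h _ _ _ hw.1 hw.2.1 hw.2.2

theorem holds_writeRule {s a b c : ℕ} : (writeRule s a b c).Holds A v ↔
    ∀ x, A.P s x → A.P a x → ∃ t z y,
      InducedSucc A.lt₁ x t ∧ InducedSucc A.lt₂ t z ∧ Path A z [b, c] y := by
  simp only [writeRule, holds_all, holds_imp, holds_and, Holds, Path]
  constructor
  · intro h x hs ha
    obtain ⟨u, hu, h₁, h₂, h₃, h₄, h₅, h₆, h₇, h₈⟩ :=
      h (fun n => [x].getD n (v n)) (by rintro (_ | x) hx <;> simp_all) ⟨hs, ha⟩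
    rw [hu 0 (by simp)] at h₁
    exact ⟨_, _, _, h₁, h₂, h₃, _, _, h₄, h₅, h₆, _, _, h₇, h₈, rfl⟩
  · rintro h w - ⟨hs, ha⟩
    obtain ⟨t, z, y, h₁, h₂, h₃, r, y', h₄, h₅, h₆, r', y'', h₇, h₈, rfl⟩ := h _ hs ha
    refine ⟨fun n => [w 0, t, z, r, y', r', y''].getD n (w n), ?_,
      h₁, h₂, h₃, h₄, h₅, h₆, h₇, h₈⟩
    rintro (_ | _ | _ | _ | _ | _ | _ | x) hx <;> simp_all

theorem holds_moveRule {s a s' : ℕ} : (moveRule s a s').Holds A v ↔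
    ∀ x t y t' z r z' r' z'', A.P s x → A.P a x → InducedSucc A.lt₁ x t → InducedSucc A.lt₁ t y →
      InducedSucc A.lt₁ y t' → InducedSucc A.lt₂ t z → InducedSucc A.lt₁ z r →
      InducedSucc A.lt₁ r z' → InducedSucc A.lt₁ z' r' → InducedSucc A.lt₁ r' z'' →
      A.P s' y ∧ InducedSucc A.lt₂ t' z'' := by
  simp only [moveRule, holds_all, holds_imp, holds_and, Holds]
  constructor
  · intro h x t y t' z r z' r' z'' h₁ h₂ h₃ h₄ h₅ h₆ h₇ h₈ h₉ h₀
    refine h (fun n => [x, t, y, t', z, r, z', r', z''].getD n (v n)) ?_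
      ⟨h₁, h₂, h₃, h₄, h₅, h₆, h₇, h₈, h₉, h₀⟩
    intro n hn
    simp only [List.mem_cons, List.not_mem_nil, or_false, not_or] at hn
    exact List.getD_eq_default _ _ (by simp only [List.length_cons, List.length_nil]; omega)
  · rintro h w - ⟨h₁, h₂, h₃, h₄, h₅, h₆, h₇, h₈, h₉, h₀⟩
    exact h _ _ _ _ _ _ _ _ _ h₁ h₂ h₃ h₄ h₅ h₆ h₇ h₈ h₉ h₀

theorem holds_forbidRule {s a : ℕ} :
    (forbidRule s a).Holds A v ↔ ∀ x, A.P s x → ¬ A.P a x := by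
  simp only [forbidRule, holds_all, holds_imp, Holds]
  constructor
  · intro h x
    refine h (fun n => [x].getD n (v n)) ?_
    rintro (_ | x) hx <;> simp_all
  · intro h w _
    exact h _

end Semantics

end OneDim

/-! ### Queue machines and the word of letters they read. -/

namespace OneDim
open Formula

/-- A machine with a queue: in state `s` it removes the first letter `a` of the queue, appends two
letters, and changes its state, as prescribed by `trans s a`; it stops if this is undefined. The
states that can occur are among the finitely many in `states`. -/
structure QueueMachine (S A : Type) where
  trans : S → A → Option (S × A × A)
  start : S
  states : Finset S
  start_mem : start ∈ states
  trans_mem : ∀ s ∈ states, ∀ a r, trans s a = some r → r.1 ∈ states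

namespace QueueMachine

variable {S A : Type}

/-- One step of the machine. -/
def step (Q : QueueMachine S A) : S × List A → Option (S × List A)
  | (_, []) => none
  | (s, a :: w) => (Q.trans s a).map fun r => (r.1, w ++ [r.2.1, r.2.2])

variable (Q : QueueMachine S A)

/-- One step of the machine, which goes on in an irrelevant way where it should stop. -/
def next : S × List A → S × List A
  | (s, []) => (s, [])
  | (s, a :: w) =>
    (((Q.trans s a).getD (s, a, a)).1,
      w ++ [((Q.trans s a).getD (s, a, a)).2.1, ((Q.trans s a).getD (s, a, a)).2.2])

/-- The configuration after `i` steps on the input `w`. -/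
def run (w : List A) (i : ℕ) : S × List A := Q.next^[i] (Q.start, w)

/-- The machine stops on the input `w`. -/
def Halts (w : List A) : Prop :=
  (StateTransition.eval Q.step (Q.start, w)).Dom

theorem run_zero (w : List A) : Q.run w 0 = (Q.start, w) := rfl

theorem run_succ (w : List A) (i : ℕ) :
    Q.run w (i + 1) = Q.next (Q.run w i) := Function.iterate_succ_apply' _ _ _

theorem next_eq_of_step {c c' : S × List A} (h : Q.step c = some c') : Q.next c = c' := by
  obtain ⟨s, _ | ⟨a, w⟩⟩ := c
  · simp [step] at h
  simp only [step, Option.map_eq_some_iff] at h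
  obtain ⟨r, hr, rfl⟩ := h
  simp [next, hr]

/-- The total function `next` agrees with `step` until the machine first stops, so minimality of the
stopping time suffices. -/
theorem halts_iff {w : List A} : Q.Halts w ↔ ∃ i, Q.step (Q.run w i) = none := by
  constructor
  · intro h
    obtain ⟨h₁, h₂⟩ := StateTransition.mem_eval.1 (Part.get_mem h)
    suffices ∀ c, StateTransition.Reaches Q.step (Q.start, w) c → ∃ i, Q.run w i = c by
      obtain ⟨i, hi⟩ := this _ h₁
      exact ⟨i, hi.symm ▸ h₂⟩
    intro c hc
    induction hc with
    | refl => exact ⟨0, rfl⟩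
    | tail _ h ih =>
      obtain ⟨i, rfl⟩ := ih
      exact ⟨i + 1, by rw [run_succ, Q.next_eq_of_step h]⟩
  · intro h
    classical
    have hr : ∀ i ≤ Nat.find h, StateTransition.Reaches Q.step (Q.start, w) (Q.run w i) := by
      intro i
      induction i with
      | zero => exact fun _ => .refl
      | succ i ih =>
        intro hi
        obtain ⟨c, hc⟩ := Option.ne_none_iff_exists'.1 (Nat.find_min h hi)
        refine (ih (by omega)).tail ?_
        rw [run_succ, Q.next_eq_of_step hc]
        exact hc
    exact Part.dom_iff_mem.2
      ⟨_, StateTransition.mem_eval.2 ⟨hr _ le_rfl, Nat.find_spec h⟩⟩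

theorem run_fst_mem (w : List A) (i : ℕ) : (Q.run w i).1 ∈ Q.states := by
  induction i with
  | zero => exact Q.start_mem
  | succ i ih =>
    rw [run_succ]
    rcases hc : Q.run w i with ⟨s, _ | ⟨a, v⟩⟩
    · rwa [hc] at ih
    · rw [hc] at ih
      rcases h : Q.trans s a with _ | r
      · simpa [next, h] using ih
      · simpa [next, h] using Q.trans_mem s ih a r h

theorem length_run {w : List A} (hw : w ≠ []) (i : ℕ) :
    (Q.run w i).2.length = w.length + i := by
  induction i with
  | zero => rfl
  | succ i ih =>
    have := List.length_pos_iff.2 hw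
    rw [run_succ]
    rcases hc : Q.run w i with ⟨s, _ | ⟨a, v⟩⟩
    · simp only [hc, List.length_nil] at ih; omega
    · simp only [hc, List.length_cons] at ih
      simp only [next, List.length_append, List.length_cons, List.length_nil]; omega

/-- The letter that is read in step `i` on the input `w`. -/
def word (w : List A) (i : ℕ) : Option A := (Q.run w i).2.head?

theorem exists_run_eq {w : List A} (hw : w ≠ []) (i : ℕ) :
    ∃ a v, Q.run w i = ((Q.run w i).1, a :: v) ∧ Q.word w i = some a := by
  have h := Q.length_run hw i
  have := List.length_pos_iff.2 hw
  rw [word]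
  generalize Q.run w i = c at h ⊢
  obtain ⟨s, _ | ⟨a, v⟩⟩ := c
  · simp only [List.length_nil] at h; omega
  · exact ⟨a, v, rfl, rfl⟩

/-- First in, first out: a letter at place `j` of the queue is read `j` steps later. All queues are
thus windows of the single word `Q.word w`. -/
theorem getElem?_run {w : List A} (hw : w ≠ []) (i j : ℕ) (h : j < w.length + i) :
    (Q.run w i).2[j]? = Q.word w (i + j) := by
  induction j generalizing i with
  | zero => rw [word, List.head?_eq_getElem?, add_zero]
  | succ j ih =>
    obtain ⟨a, v, hc, -⟩ := Q.exists_run_eq hw i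
    have hl := Q.length_run hw i
    rw [hc] at hl
    rw [show i + (j + 1) = i + 1 + j by omega, ← ih (i + 1) (by omega), run_succ, hc]
    simp only [List.length_cons] at hl
    simp [next, List.getElem?_append_left (show j < v.length by omega)]

theorem word_of_lt {w : List A} (hw : w ≠ []) {i : ℕ} (h : i < w.length) :
    Q.word w i = some w[i] := by
  have h' := Q.getElem?_run hw 0 i (by omega)
  rw [zero_add] at h'
  simp [← h', run_zero, h]

/-- Before step `i` the queue occupies the positions from `i` up to but excluding `w.length + 2 *
i`; the two new letters come next. -/
theorem run_succ_of_trans {w : List A} (hw : w ≠ []) {i : ℕ} {a : A} {r : S × A × A}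
    (ha : Q.word w i = some a) (hr : Q.trans (Q.run w i).1 a = some r) :
    (Q.run w (i + 1)).1 = r.1 ∧ Q.word w (w.length + 2 * i) = some r.2.1 ∧
      Q.word w (w.length + 2 * i + 1) = some r.2.2 := by
  have := List.length_pos_iff.2 hw
  obtain ⟨a', v, hc, ha'⟩ := Q.exists_run_eq hw i
  obtain rfl : a' = a := by simpa [ha] using ha'.symm
  have hl := Q.length_run hw i
  rw [hc] at hl
  simp only [List.length_cons] at hl
  have hs : Q.run w (i + 1) = (r.1, v ++ [r.2.1, r.2.2]) := by
    rw [run_succ, hc]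
    simp [next, hr]
  have h₁ := Q.getElem?_run hw (i + 1) (w.length + i - 1) (by omega)
  have h₂ := Q.getElem?_run hw (i + 1) (w.length + i) (by omega)
  rw [hs, List.getElem?_append_right (by omega)] at h₁ h₂
  rw [show w.length + i - 1 - v.length = 0 by omega,
    show i + 1 + (w.length + i - 1) = w.length + 2 * i by omega] at h₁
  rw [show w.length + i - v.length = 1 by omega,
    show i + 1 + (w.length + i) = w.length + 2 * i + 1 by omega] at h₂
  exact ⟨by rw [hs], h₁.symm, h₂.symm⟩

theorem step_run_eq_none_iff {w : List A} {i : ℕ} {a : A} (ha : Q.word w i = some a) :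
    Q.step (Q.run w i) = none ↔ Q.trans (Q.run w i).1 a = none := by
  obtain ⟨v, hv⟩ := List.head?_eq_some_iff.1 ha
  rw [show Q.run w i = ((Q.run w i).1, a :: v) by rw [← hv]]
  simp [step]

/-! ### The sentence belonging to a machine and an input. -/

open Classical in
/-- The index of the predicate for a state. -/
noncomputable def state (s : S) : ℕ := 2 * Q.states.toList.idxOf s + 3

theorem state_inj {s s' : S} (hs : s ∈ Q.states) (h : Q.state s = Q.state s') : s = s' := by
  classical
  simp only [state, Nat.add_right_cancel_iff, Nat.mul_left_cancel_iff (Nat.succ_pos 1)] at h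
  exact (List.idxOf_inj (Finset.mem_toList.2 hs)).1 h

variable [Encodable A]

/-- The index of the predicate for a letter. -/
def letter (a : A) : ℕ := 2 * Encodable.encode a + 2

/-- Letters have even indices from `2` on and states odd indices from `3` on, which keeps them apart
from each other and from the marks `0` and `1`. -/
theorem letter_injective : Function.Injective (letter : A → ℕ) := fun a b h =>
  Encodable.encode_injective (by simpa [letter] using h)

/-- The condition on the transition that reads `a` in state `s`. -/
noncomputable def transRule (forbid : Bool) (s : S) (a : A) : Formula :=
  match Q.trans s a with
  | none => if forbid then forbidRule (Q.state s) (letter a) else conj []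
  | some r => and (writeRule (Q.state s) (letter a) (letter r.2.1) (letter r.2.2))
      (moveRule (Q.state s) (letter a) (Q.state r.1))

theorem isF1_transRule (forbid : Bool) (s : S) (a : A) : IsF1 (Q.transRule forbid s a) := by
  unfold transRule
  split
  · split_ifs
    · exact isF1_forbidRule _ _
    · exact IsF1.conj [] (by simp)
  · exact (isF1_writeRule _ _ _ _).and (isF1_moveRule _ _ _)

theorem free_transRule (forbid : Bool) (s : S) (a : A) : (Q.transRule forbid s a).free = ∅ := by
  unfold transRule
  split
  · split_ifs <;> rfl
  · rfl

variable [Fintype A]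

/-- The conditions on a structure that represents a computation, independent of the input. If
`forbid` is true, then the computation must not stop. -/
noncomputable def theory (forbid : Bool) : Formula :=
  and (stateRule (Q.state Q.start)) (and matchRule
    (conj ((Q.states ×ˢ Finset.univ).toList.map fun p => Q.transRule forbid p.1 p.2)))

/-- The sentence that describes the computation on the input `w`. -/
noncomputable def sentence (forbid : Bool) (w : List A) : Formula :=
  and (initRule (w.map letter)) (Q.theory forbid)

theorem isF1_sentence (forbid : Bool) (w : List A) : IsF1 (Q.sentence forbid w) := by
  refine (isF1_initRule _).and ((isF1_stateRule _).and (isF1_matchRule.and (IsF1.conj _ ?_)))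
  simp only [List.mem_map]
  rintro _ ⟨p, -, rfl⟩
  exact Q.isF1_transRule _ _ _

theorem isSentence_sentence (forbid : Bool) (w : List A) : (Q.sentence forbid w).IsSentence := by
  have h : (conj ((Q.states ×ˢ Finset.univ).toList.map
      fun p => Q.transRule forbid p.1 p.2)).free = ∅ := by
    refine free_conj _ ?_
    simp only [List.mem_map]
    rintro _ ⟨p, -, rfl⟩
    exact Q.free_transRule _ _ _
  rw [IsSentence, sentence, theory, free_and, free_and, free_and, h, free_initRule]
  rfl

/-- The structure `B` satisfies the conditions on a structure that represents a computation. -/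
structure Describes {M : Type} (B : BiorderedStructure M) : Prop where
  state : ∀ x, B.P 0 x → B.P (Q.state Q.start) x
  link : ∀ x t z, B.P 0 x → InducedSucc B.lt₁ x t → B.P 1 z → InducedSucc B.lt₂ t z
  write : ∀ s ∈ Q.states, ∀ a r, Q.trans s a = some r → ∀ x, B.P (Q.state s) x →
    B.P (letter a) x → ∃ t z y, InducedSucc B.lt₁ x t ∧ InducedSucc B.lt₂ t z ∧
      Path B z [letter r.2.1, letter r.2.2] y
  move : ∀ s ∈ Q.states, ∀ a r, Q.trans s a = some r → ∀ x t y t' z u z' u' z'',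
    B.P (Q.state s) x → B.P (letter a) x → InducedSucc B.lt₁ x t → InducedSucc B.lt₁ t y →
      InducedSucc B.lt₁ y t' → InducedSucc B.lt₂ t z → InducedSucc B.lt₁ z u →
      InducedSucc B.lt₁ u z' → InducedSucc B.lt₁ z' u' → InducedSucc B.lt₁ u' z'' →
      B.P (Q.state r.1) y ∧ InducedSucc B.lt₂ t' z''

/-- No transition that stops the machine occurs in the structure `B`. -/
def NeverStops {M : Type} (B : BiorderedStructure M) : Prop :=
  ∀ s ∈ Q.states, ∀ a, Q.trans s a = none → ∀ x, B.P (Q.state s) x → ¬ B.P (letter a) x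

variable {M : Type} {B : BiorderedStructure M} {v : ℕ → M}

theorem holds_theory {forbid : Bool} :
    (Q.theory forbid).Holds B v ↔ Q.Describes B ∧ (forbid = true → Q.NeverStops B) := by
  simp only [theory, holds_and, holds_stateRule, holds_matchRule, holds_conj, List.mem_map,
    Finset.mem_toList, Finset.mem_product, Finset.mem_univ, and_true, forall_exists_index,
    and_imp, forall_apply_eq_imp_iff₂]
  constructor
  · rintro ⟨h₁, h₂, h⟩
    refine ⟨⟨h₁, h₂, fun s hs a r hr => ?_, fun s hs a r hr => ?_⟩, fun hf s hs a hr => ?_⟩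
    all_goals
      have h := h (s, a) hs
      simp only [transRule, *, holds_and, holds_writeRule, holds_moveRule, holds_forbidRule,
        if_true] at h
    exacts [h.1, h.2, h]
  · rintro ⟨⟨h₁, h₂, h₃, h₄⟩, h₅⟩
    refine ⟨h₁, h₂, fun ⟨s, a⟩ hs => ?_⟩
    unfold transRule
    rcases hr : Q.trans s a with _ | r
    · split_ifs with hf
      · exact holds_forbidRule.2 (h₅ hf s hs a hr)
      · exact holds_conj.2 (by simp)
    · exact holds_and.2 ⟨holds_writeRule.2 (h₃ s hs a r hr), holds_moveRule.2 (h₄ s hs a r hr)⟩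

theorem holds_sentence {forbid : Bool} {w : List A} : (Q.sentence forbid w).Holds B v ↔
    (∃ x z, B.P 0 x ∧ Path B x (w.map letter) z ∧ B.P 1 z) ∧
      Q.Describes B ∧ (forbid = true → Q.NeverStops B) := by
  rw [sentence, holds_and, holds_initRule, holds_theory]

end QueueMachine

/-! ### From models to computations. -/

section Succ

variable {M : Type} {lt : M → M → Prop}

theorem InducedSucc.right_unique (h : IsStrictTotalOrder M lt) {a b c : M}
    (hb : InducedSucc lt a b) (hc : InducedSucc lt a c) : b = c := by
  rcases trichotomous_of lt b c with hbc | rfl | hcb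
  · exact (hc.2 ⟨b, hb.1, hbc⟩).elim
  · rfl
  · exact (hb.2 ⟨c, hc.1, hcb⟩).elim

end Succ

theorem Path.append {M : Type} {B : BiorderedStructure M} {w w' : List ℕ} {x y z : M}
    (h : Path B x w y) (h' : Path B y w' z) : Path B x (w ++ w') z := by
  induction w generalizing x with
  | nil => exact h.symm ▸ h'
  | cons a w ih =>
    obtain ⟨ha, t, u, h₁, h₂, h⟩ := h
    exact ⟨ha, t, u, h₁, h₂, ih h⟩

namespace QueueMachine

variable {S A : Type} [Encodable A] (Q : QueueMachine S A)
  {M : Type} {B : BiorderedStructure M}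

/-- The configuration `c` is represented in `B` with its first letter at `x`. -/
def At (B : BiorderedStructure M) (c : S × List A) (x : M) : Prop :=
  B.P (Q.state c.1) x ∧ ∃ t z, Path B x (c.2.map letter) z ∧ InducedSucc B.lt₁ x t ∧
    InducedSucc B.lt₂ t z

variable {Q}

theorem Describes.at_start (h : Q.Describes B) {w : List A} (hw : w ≠ []) {x z : M}
    (hx : B.P 0 x) (hxz : Path B x (w.map letter) z) (hz : B.P 1 z) : Q.At B (Q.start, w) x := by
  obtain ⟨a, w, rfl⟩ := List.exists_cons_of_ne_nil hw
  obtain ⟨-, t, -, ht, -⟩ := id hxz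
  exact ⟨h.state x hx, t, z, hxz, ht, h.link x t z hx ht hz⟩

/-- The end of the queue is the `succ₂`-successor of the reader of its first letter. The write rule
extends the path beyond that end, and the move rule restores the link for the next reader and the
new end. -/
theorem Describes.at_step (h : Q.Describes B) {c c' : S × List A} (hc : c.1 ∈ Q.states)
    (hcc' : Q.step c = some c') {x : M} (hx : Q.At B c x) : ∃ x', B.lt₁ x x' ∧ Q.At B c' x' := by
  obtain ⟨s, _ | ⟨a, w⟩⟩ := c
  · simp [step] at hcc'
  simp only [step, Option.map_eq_some_iff] at hcc'
  obtain ⟨r, hr, rfl⟩ := hcc'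
  obtain ⟨hs, t, z, ⟨ha, t', y, h₁, h₂, hyz⟩, h₃, h₄⟩ := hx
  obtain rfl := h₁.right_unique B.linear₁ h₃
  obtain ⟨t₂, z₂, z'', h₅, h₆, h₇⟩ := h.write s hc a r hr x hs ha
  -- The write rule only asserts that some place for the output exists; uniqueness of successors in
  -- both orders identifies it with the end of the queue.
  obtain rfl := h₅.right_unique B.linear₁ h₃
  obtain rfl := h₆.right_unique B.linear₂ h₄
  have hp : Path B y ((w ++ [r.2.1, r.2.2]).map letter) z'' := by
    rw [List.map_append]
    exact hyz.append h₇
  -- No rule asserts that the next reader exists; it lies on the path because the new queue is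
  -- nonempty.
  obtain ⟨t', ht'⟩ : ∃ t', InducedSucc B.lt₁ y t' := by
    obtain ⟨b, w', hw'⟩ := List.exists_cons_of_ne_nil
      (show (w ++ [r.2.1, r.2.2]).map letter ≠ [] by simp)
    rw [hw'] at hp
    obtain ⟨-, t', -, ht', -⟩ := hp
    exact ⟨t', ht'⟩
  obtain ⟨-, u, z', hu, hz', -, u', _, hu', hz'', rfl⟩ := h₇
  obtain ⟨h₈, h₉⟩ := h.move s hc a r hr x _ y t' _ u z' u' _ hs ha h₃ h₂ ht' h₄ hu hz' hu' hz''
  have := B.linear₁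
  exact ⟨y, _root_.trans h₁.1 h₂.1, h₈, t', _, hp, ht', h₉⟩

/-- Every step moves strictly up in the first order, so predecessors accumulate. Their count is
restricted to finite `M` because `ncard` is `0` on infinite sets. -/
theorem Describes.at_run (h : Q.Describes B) {w : List A} {x₀ : M} (hx₀ : Q.At B (Q.start, w) x₀)
    {i : ℕ} (hi : ∀ j < i, Q.step (Q.run w j) ≠ none) :
    ∃ x, Q.At B (Q.run w i) x ∧ (Finite M → i ≤ {y | B.lt₁ y x}.ncard) := by
  induction i with
  | zero => exact ⟨x₀, hx₀, fun _ => Nat.zero_le _⟩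
  | succ i ih =>
    obtain ⟨x, hx, hx'⟩ := ih fun j hj => hi j (by omega)
    obtain ⟨c, hc⟩ := Option.ne_none_iff_exists'.1 (hi i (by omega))
    obtain ⟨y, hxy, hy⟩ := h.at_step (Q.run_fst_mem w i) hc hx
    refine ⟨y, by rwa [run_succ, Q.next_eq_of_step hc], fun hM => (hx' hM).trans_lt ?_⟩
    have := B.linear₁
    refine Set.ncard_lt_ncard ⟨fun z hz => _root_.trans (show B.lt₁ z x from hz) hxy, fun hs => ?_⟩
    exact irrefl_of B.lt₁ x (hs hxy)

variable [Fintype A]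

theorem halts_of_satisfiableOver_finite {w : List A} (hw : w ≠ [])
    (h : SatisfiableOver finiteStructures (Q.sentence false w)) : Q.Halts w := by
  obtain ⟨M, B, hM, v, hv⟩ := h
  obtain ⟨⟨x, z, hx, hxz, hz⟩, hB, -⟩ := Q.holds_sentence.1 hv
  have hM : Finite M := hM
  by_contra hh
  rw [Q.halts_iff, not_exists] at hh
  obtain ⟨y, -, hy⟩ := hB.at_run (hB.at_start hw hx hxz hz) (i := Nat.card M + 1) fun j _ => hh j
  have := hy hM
  have := Set.ncard_le_card {z | B.lt₁ z y}
  omega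

/-- The run unfolds in the model up to its first stopping configuration, where a forbidden pair of
state and letter would meet. -/
theorem not_halts_of_satisfiableOver_all {w : List A} (hw : w ≠ [])
    (h : SatisfiableOver allStructures (Q.sentence true w)) : ¬ Q.Halts w := by
  obtain ⟨M, B, -, v, hv⟩ := h
  obtain ⟨⟨x, z, hx, hxz, hz⟩, hB, hs⟩ := Q.holds_sentence.1 hv
  intro hh
  classical
  have hh := Q.halts_iff.1 hh
  have hi := Nat.find_spec hh
  obtain ⟨y, ⟨hy, t, z, hy', -⟩, -⟩ := hB.at_run (hB.at_start hw hx hxz hz) (i := Nat.find hh)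
    fun j hj => Nat.find_min hh hj
  obtain ⟨a, u, hc, ha⟩ := Q.exists_run_eq hw (Nat.find hh)
  rw [hc] at hy'
  exact hs rfl _ (Q.run_fst_mem w _) a ((Q.step_run_eq_none_iff ha).1 hi) y hy hy'.1

end QueueMachine

end OneDim

/-! ### From computations to models. -/

namespace OneDim
open Formula

theorem isStrictTotalOrder_lt_of_injective {M : Type} {f : M → ℕ} (hf : Function.Injective f) :
    IsStrictTotalOrder M fun a b => f a < f b :=
  (RelEmbedding.preimage ⟨f, hf⟩ ((· < ·) : ℕ → ℕ → Prop)).isStrictTotalOrder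

/-- The image of `f` is an infinite subset of `ℕ`, hence of order type `ℕ`. -/
theorem nonempty_relIso_nat {M : Type} [Infinite M] {f : M → ℕ} (hf : Function.Injective f) :
    Nonempty ((fun a b => f a < f b) ≃r ((· < ·) : ℕ → ℕ → Prop)) := by
  classical
  have : Infinite (Set.range f) := Set.infinite_coe_iff.2 (Set.infinite_range_of_injective hf)
  let e := Nat.Subtype.orderIsoOfNat (Set.range f)
  refine ⟨⟨(Equiv.ofInjective f hf).trans e.symm.toEquiv, fun {a b} => ?_⟩⟩
  exact e.symm.lt_iff_lt (x := Equiv.ofInjective f hf a) (y := Equiv.ofInjective f hf b)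

theorem inducedSucc_of_eq_add_one {M : Type} {f : M → ℕ} {a b : M} (h : f b = f a + 1) :
    InducedSucc (fun a b => f a < f b) a b :=
  ⟨by omega, fun ⟨c, h₁, h₂⟩ => by omega⟩

/-- The place of an element in the second order: the reader `2 * i + 1` of cell `i` is followed by
cell `k + 2 * i`, where the letters that are written in step `i` begin. -/
def matchPos (k n : ℕ) : ℕ :=
  if n % 2 = 1 then 3 * (n / 2)
  else if k ≤ n / 2 ∧ (n / 2 - k) % 2 = 0 then 3 * ((n / 2 - k) / 2) + 1
  else 3 * (n / 2) + 2

/-- The three cases have values in different residue classes mod `3`, and within each case `n` can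
be recovered. -/
theorem matchPos_injective (k : ℕ) : Function.Injective (matchPos k) := by
  intro m n h
  unfold matchPos at h
  split_ifs at h <;> omega

theorem matchPos_reader (k i : ℕ) : matchPos k (2 * i + 1) = 3 * i := by
  unfold matchPos
  split_ifs <;> omega

theorem matchPos_cell (k i : ℕ) : matchPos k (2 * (k + 2 * i)) = 3 * i + 1 := by
  unfold matchPos
  split_ifs <;> omega

namespace QueueMachine

variable {S A : Type} [Encodable A] (Q : QueueMachine S A)

/-- The structure that represents the computation on the input `w`, restricted to the elements of
`D`, with the states marked only in the steps that belong to `act`. Cell `i` consists of the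
element `2 * i`, which carries the letter, and the reader `2 * i + 1`. -/
def model (w : List A) (D : Set ℕ) (act : ℕ → Prop) : BiorderedStructure D where
  lt₁ a b := a.1 < b.1
  lt₂ a b := matchPos w.length a.1 < matchPos w.length b.1
  linear₁ := isStrictTotalOrder_lt_of_injective Subtype.val_injective
  linear₂ := isStrictTotalOrder_lt_of_injective
    ((matchPos_injective w.length).comp Subtype.val_injective)
  P j a := ∃ i, a.1 = 2 * i ∧ (j = 0 ∧ i = 0 ∨ j = 1 ∧ i = w.length ∨
    (∃ b, Q.word w i = some b ∧ j = letter b) ∨ act i ∧ j = Q.state (Q.run w i).1)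

variable {Q} {w : List A} {D : Set ℕ} {act : ℕ → Prop}

theorem model_P_zero {x : D} : (Q.model w D act).P 0 x ↔ x.1 = 0 := by
  simp [model, letter, state]

theorem model_P_one {x : D} : (Q.model w D act).P 1 x ↔ x.1 = 2 * w.length := by
  simp [model, letter, state]

theorem model_P_letter {x : D} {a : A} : (Q.model w D act).P (letter a) x ↔
    ∃ i, x.1 = 2 * i ∧ Q.word w i = some a := by
  simp only [model]
  refine exists_congr fun i => and_congr_right fun _ =>
    ⟨?_, fun h => .inr (.inr (.inl ⟨a, h, rfl⟩))⟩
  rintro (⟨h, -⟩ | ⟨h, -⟩ | ⟨b, hb, h⟩ | ⟨-, h⟩)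
  · simp [letter] at h
  · simp [letter] at h
  · rw [hb, letter_injective h]
  · simp only [letter, state] at h; omega

theorem model_P_state {x : D} {s : S} (hs : s ∈ Q.states) : (Q.model w D act).P (Q.state s) x ↔
    ∃ i, x.1 = 2 * i ∧ act i ∧ (Q.run w i).1 = s := by
  simp only [model]
  refine exists_congr fun i => and_congr_right fun _ =>
    ⟨?_, fun h => .inr (.inr (.inr ⟨h.1, by rw [h.2]⟩))⟩
  rintro (⟨h, -⟩ | ⟨h, -⟩ | ⟨b, hb, h⟩ | ⟨h', h⟩)
  · simp [state] at h
  · simp [state] at h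
  · simp only [letter, state] at h; omega
  · exact ⟨h', (Q.state_inj hs h).symm⟩

/-- A lower set has no gaps, so restricting to `D` creates no new successors. -/
theorem model_succ₁ (hD : IsLowerSet D) {x y : D} :
    InducedSucc (Q.model w D act).lt₁ x y ↔ y.1 = x.1 + 1 := by
  refine ⟨fun h => ?_, inducedSucc_of_eq_add_one⟩
  by_contra hne
  have h₁ : x.1 < y.1 := h.1
  exact h.2 ⟨⟨x.1 + 1, hD (by omega) y.2⟩, Nat.lt_succ_self _, show x.1 + 1 < y.1 by omega⟩

/-- The two places are the consecutive numbers `3 * i` and `3 * i + 1`, so nothing can lie between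
them. Other `succ₂`-pairs need no analysis, since successors are unique. -/
theorem model_succ₂ {x y : D} {i : ℕ} (hx : x.1 = 2 * i + 1) (hy : y.1 = 2 * (w.length + 2 * i)) :
    InducedSucc (Q.model w D act).lt₂ x y := by
  refine inducedSucc_of_eq_add_one (f := fun a : D => matchPos w.length a.1) ?_
  simp only [hx, hy, matchPos_reader, matchPos_cell]

theorem model_path (hD : IsLowerSet D) (u : List A) (i : ℕ)
    (hu : ∀ j (h : j < u.length), Q.word w (i + j) = some u[j]) {x z : D} (hx : x.1 = 2 * i)
    (hz : z.1 = 2 * (i + u.length)) :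
    Path (Q.model w D act) x (u.map letter) z := by
  induction u generalizing i x with
  | nil => exact Subtype.ext (by simp_all)
  | cons a u ih =>
    simp only [List.length_cons] at hz
    refine ⟨model_P_letter.2 ⟨i, hx, hu 0 (by simp)⟩, ⟨2 * i + 1, hD (by omega) z.2⟩,
      ⟨2 * (i + 1), hD (by omega) z.2⟩, (model_succ₁ hD).2 (by simp [hx]),
      (model_succ₁ hD).2 (by simp only; omega), ih (i + 1) ?_ rfl (by omega)⟩
    intro j hj
    rw [show i + 1 + j = i + (j + 1) by omega]
    exact hu (j + 1) (by simpa using hj)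

/-- A marked step `i` forces the structure to reach the element after the two letters it writes,
which is `2 * (w.length + 2 * i + 2)`, and forces the next step to be marked if there is a
transition. -/
theorem model_describes (hw : w ≠ []) (hD : IsLowerSet D)
    (hDa : ∀ i, act i → 2 * (w.length + 2 * i + 2) ∈ D) (ha₀ : act 0)
    (ha : ∀ i a r, act i → Q.word w i = some a → Q.trans (Q.run w i).1 a = some r → act (i + 1)) :
    Q.Describes (Q.model w D act) where
  state x hx := (model_P_state Q.start_mem).2 ⟨0, by simpa using model_P_zero.1 hx, ha₀, rfl⟩
  link x t z hx ht hz := by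
    rw [model_P_zero] at hx
    rw [model_P_one] at hz
    rw [model_succ₁ hD] at ht
    exact model_succ₂ (i := 0) (by omega) (by omega)
  write s hs a r hr x hx hxa := by
    obtain ⟨i, hi, hai, rfl⟩ := (model_P_state hs).1 hx
    obtain ⟨i', hi', hia⟩ := model_P_letter.1 hxa
    obtain rfl : i' = i := by omega
    obtain ⟨-, h₁, h₂⟩ := Q.run_succ_of_trans hw hia hr
    have hd := hDa _ hai
    refine ⟨⟨2 * i' + 1, hD (by omega) hd⟩, ⟨2 * (w.length + 2 * i'), hD (by omega) hd⟩,
      ⟨_, hd⟩, (model_succ₁ hD).2 (by simp only; omega), model_succ₂ rfl rfl,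
      model_path hD [r.2.1, r.2.2] _ ?_ rfl rfl⟩
    rintro (_ | _ | j) hj
    · simpa using h₁
    · simpa using h₂
    · simp at hj
  move s hs a r hr x t y t' z u z' u' z'' hx hxa ht hy ht' hz hu hz' hu' hz'' := by
    obtain ⟨i, hi, hai, rfl⟩ := (model_P_state hs).1 hx
    obtain ⟨i', hi', hia⟩ := model_P_letter.1 hxa
    obtain rfl : i' = i := by omega
    obtain ⟨h₀, -, -⟩ := Q.run_succ_of_trans hw hia hr
    have hd := hDa _ hai
    rw [model_succ₁ hD] at ht hy ht' hu hz' hu' hz''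
    have hzz : z = ⟨2 * (w.length + 2 * i'), hD (by omega) hd⟩ :=
      hz.right_unique (Q.model w D act).linear₂ (model_succ₂ (by omega) rfl)
    have hzz := congrArg Subtype.val hzz
    simp only at hzz
    exact ⟨(model_P_state (Q.trans_mem _ hs a r hr)).2
      ⟨i' + 1, by omega, ha _ a r hai hia hr, h₀⟩, model_succ₂ (i := i' + 1) (by omega) (by omega)⟩

variable [Fintype A]

theorem holds_model_sentence {forbid : Bool} (hw : w ≠ []) (hD : IsLowerSet D)
    (hDa : ∀ i, act i → 2 * (w.length + 2 * i + 2) ∈ D) (ha₀ : act 0)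
    (ha : ∀ i a r, act i → Q.word w i = some a → Q.trans (Q.run w i).1 a = some r → act (i + 1))
    (hf : forbid = true → Q.NeverStops (Q.model w D act)) (v : ℕ → D) :
    (Q.sentence forbid w).Holds (Q.model w D act) v := by
  have hd := hDa 0 ha₀
  refine Q.holds_sentence.2 ⟨⟨⟨0, hD (by omega) hd⟩, ⟨2 * w.length, hD (by omega) hd⟩,
    model_P_zero.2 rfl, model_path hD w 0 ?_ rfl (by simp), model_P_one.2 rfl⟩,
    model_describes hw hD hDa ha₀ ha, hf⟩
  intro j hj
  rw [zero_add]
  exact Q.word_of_lt hw hj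

theorem satisfiableOver_finite_of_halts (hw : w ≠ []) (h : Q.Halts w) :
    SatisfiableOver finiteStructures (Q.sentence false w) := by
  obtain ⟨n, hn⟩ := Q.halts_iff.1 h
  -- States are marked only up to the stopping time `n`; later marks would demand further elements.
  refine ⟨Set.Iic (2 * (w.length + 2 * n + 2)), Q.model w _ (· ≤ n), Set.finite_Iic _,
    fun _ => ⟨0, by simp⟩, holds_model_sentence (act := (· ≤ n)) hw (isLowerSet_Iic _) ?_
      (Nat.zero_le _) ?_ (fun h => Bool.noConfusion h) _⟩
  · intro i hi
    have hi : i ≤ n := hi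
    exact Set.mem_Iic.2 (by omega)
  · intro i a r hi ha hr
    -- Step `n` has no transition, so the marks never have to go beyond it.
    refine Nat.lt_of_le_of_ne hi ?_
    rintro rfl
    rw [Q.step_run_eq_none_iff ha, hr] at hn
    cases hn

theorem satisfiableOver_omega_of_not_halts (hw : w ≠ []) (h : ¬ Q.Halts w) :
    SatisfiableOver omegaStructures (Q.sentence true w) := by
  rw [Q.halts_iff, not_exists] at h
  have : Infinite (Set.univ : Set ℕ) := Set.infinite_coe_iff.2 Set.infinite_univ
  refine ⟨(Set.univ : Set ℕ), Q.model w _ fun _ => True,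
    ⟨nonempty_relIso_nat Subtype.val_injective,
      nonempty_relIso_nat ((matchPos_injective w.length).comp Subtype.val_injective)⟩,
    fun _ => ⟨0, trivial⟩, holds_model_sentence hw isLowerSet_univ (fun _ _ => trivial) trivial
      (fun _ _ _ _ _ _ => trivial) ?_ _⟩
  intro _ s hs a ha x hx hxa
  obtain ⟨i, hi, -, rfl⟩ := (model_P_state hs).1 hx
  obtain ⟨i', hi', hia⟩ := model_P_letter.1 hxa
  obtain rfl : i' = i := by omega
  exact h i' ((Q.step_run_eq_none_iff hia).2 ha)

theorem satisfiableOver_finite_iff (hw : w ≠ []) :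
    SatisfiableOver finiteStructures (Q.sentence false w) ↔ Q.Halts w :=
  ⟨halts_of_satisfiableOver_finite hw, satisfiableOver_finite_of_halts hw⟩

theorem satisfiableOver_all_of_satisfiableOver {K : StructureClass} {φ : Formula}
    (h : SatisfiableOver K φ) : SatisfiableOver allStructures φ :=
  let ⟨M, B, _, hv⟩ := h
  ⟨M, B, trivial, hv⟩

theorem satisfiableOver_omega_iff (hw : w ≠ []) :
    SatisfiableOver omegaStructures (Q.sentence true w) ↔ ¬ Q.Halts w :=
  ⟨fun h => not_halts_of_satisfiableOver_all hw (satisfiableOver_all_of_satisfiableOver h),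
    satisfiableOver_omega_of_not_halts hw⟩

theorem satisfiableOver_all_iff (hw : w ≠ []) :
    SatisfiableOver allStructures (Q.sentence true w) ↔ ¬ Q.Halts w :=
  ⟨not_halts_of_satisfiableOver_all hw, fun h =>
    satisfiableOver_all_of_satisfiableOver (satisfiableOver_omega_of_not_halts hw h)⟩

end QueueMachine

end OneDim

/-! ### Simulation of several stacks by one queue. -/

namespace OneDim

namespace StackSimulation

open Turing StateTransition

variable {K Γ Λ σ : Type}

/-- The symbol that a token of the queue puts on stack `k`. -/
def symbol [DecidableEq K] (k : K) : Option (K × Γ) → Option Γ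
  | none => none
  | some p => if p.1 = k then some p.2 else none

/-- The content of stack `k` if the tokens in the queue are `L`. -/
def stack [DecidableEq K] (k : K) (L : List (Option (K × Γ))) : List Γ := L.filterMap (symbol k)

/-- The list `L` with a blank token after every token. -/
def pad (L : List (Option (K × Γ))) : List (Option (K × Γ)) := L.flatMap fun t => [t, none]

theorem reaches_refl {α : Type} (f : α → Option α) (a : α) : Reaches f a a := .refl

theorem reaches_head {α : Type} {f : α → Option α} {a b c : α} (h : f a = some b)
    (h' : Reaches f b c) : Reaches f a c := .head h h'

theorem symbol_none [DecidableEq K] (k : K) : symbol k (none : Option (K × Γ)) = none := rfl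

theorem stack_nil [DecidableEq K] (k : K) : stack k ([] : List (Option (K × Γ))) = [] := rfl

theorem stack_append [DecidableEq K] (k : K) (L L' : List (Option (K × Γ))) :
    stack k (L ++ L') = stack k L ++ stack k L' := List.filterMap_append

theorem stack_none_cons [DecidableEq K] (k : K) (L : List (Option (K × Γ))) :
    stack k (none :: L) = stack k L := rfl

theorem stack_cons [DecidableEq K] (k : K) (t : Option (K × Γ)) (L : List (Option (K × Γ))) :
    stack k (t :: L) = (symbol k t).toList ++ stack k L := by
  rw [stack, List.filterMap_cons]
  cases symbol k t <;> rfl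

theorem pad_cons (t : Option (K × Γ)) (L : List (Option (K × Γ))) :
    pad (t :: L) = t :: none :: pad L := rfl

theorem stack_pad [DecidableEq K] (k : K) (L : List (Option (K × Γ))) :
    stack k (pad L) = stack k L := by
  induction L with
  | nil => rfl
  | cons t L ih => rw [pad_cons, stack_cons, stack_none_cons, stack_cons, ih]

/-- States of the queue machine that simulates a machine with several stacks: it has stopped, it
is about to execute a statement, or it searches the queue for the top symbol of the stack on which
a statement operates. -/
abbrev State (K Γ Λ σ : Type) : Type := Option (Bool × TM2.Stmt (fun _ : K => Γ) Λ σ × σ)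

/-- The letters of the queue are a mark (`none`), a blank (`some none`), and the symbols on the
stacks. -/
abbrev Letter (K Γ : Type) : Type := Option (Option (K × Γ))

/-- The transition at the mark. -/
def markTrans (M : Λ → TM2.Stmt (fun _ : K => Γ) Λ σ) (v : σ) :
    TM2.Stmt (fun _ : K => Γ) Λ σ → State K Γ Λ σ × Letter K Γ × Letter K Γ
  | .push k f q => (some (false, q, v), none, some (some (k, f v)))
  | .peek k f q => (some (true, .peek k f q, v), none, some none)
  | .pop k f q => (some (true, .pop k f q, v), none, some none)
  | .load a q => (some (false, q, a v), none, some none)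
  | .branch p q₁ q₂ => (some (false, cond (p v) q₁ q₂, v), none, some none)
  | .goto l => (some (false, M (l v), v), none, some none)
  | .halt => (none, none, some none)

/-- The transition while searching. -/
def searchTrans [DecidableEq K] (v : σ) :
    TM2.Stmt (fun _ : K => Γ) Λ σ → Letter K Γ → State K Γ Λ σ × Letter K Γ × Letter K Γ
  | .peek _ f q, none => (some (false, q, f v none), none, some none)
  | .peek k f q, some t =>
    match symbol k t with
    | none => (some (true, .peek k f q, v), some t, some none)
    | some γ => (some (false, q, f v (some γ)), some t, some none)
  | .pop _ f q, none => (some (false, q, f v none), none, some none)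
  | .pop k f q, some t =>
    match symbol k t with
    | none => (some (true, .pop k f q, v), some t, some none)
    | some γ => (some (false, q, f v (some γ)), some none, some none)
  | q, t => (some (true, q, v), t, some none)

/-- The transitions of the simulating queue machine. -/
def trans [DecidableEq K] (M : Λ → TM2.Stmt (fun _ : K => Γ) Λ σ) :
    State K Γ Λ σ → Letter K Γ → Option (State K Γ Λ σ × Letter K Γ × Letter K Γ)
  | none, _ => none
  | some (false, q, v), none => some (markTrans M v q)
  | some (false, q, v), some t => some (some (false, q, v), some t, some none)
  | some (true, q, v), t => some (searchTrans v q t)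

open Classical in
/-- The states that occur if the labels belong to `T`. -/
noncomputable def states [Fintype σ] (M : Λ → TM2.Stmt (fun _ : K => Γ) Λ σ) (T : Finset Λ) :
    Finset (State K Γ Λ σ) :=
  Finset.insertNone (Finset.univ ×ˢ T.biUnion (fun l => TM2.stmts₁ (M l)) ×ˢ Finset.univ)

section Support

variable [Fintype σ] {M : Λ → TM2.Stmt (fun _ : K => Γ) Λ σ} {T : Finset Λ}

theorem none_mem_states : none ∈ states M T := Finset.none_mem_insertNone

theorem some_mem_states {b : Bool} {q : TM2.Stmt (fun _ : K => Γ) Λ σ} {v : σ} :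
    some (b, q, v) ∈ states M T ↔ ∃ l ∈ T, q ∈ TM2.stmts₁ (M l) := by
  simp [states]

theorem mem_states_of_label {l : Λ} (hl : l ∈ T) (v : σ) : some (false, M l, v) ∈ states M T :=
  some_mem_states.2 ⟨l, hl, TM2.stmts₁_self⟩

theorem mem_states_of_mem_stmts₁ {b b' : Bool} {q q' : TM2.Stmt (fun _ : K => Γ) Λ σ} {v v' : σ}
    (h : some (b, q, v) ∈ states M T) (hq : q' ∈ TM2.stmts₁ q) :
    some (b', q', v') ∈ states M T := by
  obtain ⟨l, hl, h⟩ := some_mem_states.1 h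
  exact some_mem_states.2 ⟨l, hl, TM2.stmts₁_trans h hq⟩

theorem markTrans_mem (hT : ∀ l ∈ T, TM2.SupportsStmt T (M l)) {b : Bool}
    {q : TM2.Stmt (fun _ : K => Γ) Λ σ} {v : σ} (h : some (b, q, v) ∈ states M T) :
    (markTrans M v q).1 ∈ states M T := by
  cases q with
  | push k f q => exact mem_states_of_mem_stmts₁ h (by simp [TM2.stmts₁, TM2.stmts₁_self])
  | peek k f q => exact mem_states_of_mem_stmts₁ h TM2.stmts₁_self
  | pop k f q => exact mem_states_of_mem_stmts₁ h TM2.stmts₁_self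
  | load a q => exact mem_states_of_mem_stmts₁ h (by simp [TM2.stmts₁, TM2.stmts₁_self])
  | branch p q₁ q₂ =>
    refine mem_states_of_mem_stmts₁ h ?_
    cases p v <;> simp [TM2.stmts₁, TM2.stmts₁_self]
  | goto l =>
    obtain ⟨l', hl', h⟩ := some_mem_states.1 h
    exact mem_states_of_label (TM2.stmts₁_supportsStmt_mono h (hT l' hl') v) v
  | halt => exact none_mem_states

theorem searchTrans_mem [DecidableEq K] {b : Bool} {q : TM2.Stmt (fun _ : K => Γ) Λ σ} {v : σ}
    (h : some (b, q, v) ∈ states M T) (t : Letter K Γ) :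
    (searchTrans v q t).1 ∈ states M T := by
  unfold searchTrans
  split
  · exact mem_states_of_mem_stmts₁ h (by simp [TM2.stmts₁, TM2.stmts₁_self])
  · split
    · exact mem_states_of_mem_stmts₁ h TM2.stmts₁_self
    · exact mem_states_of_mem_stmts₁ h (by simp [TM2.stmts₁, TM2.stmts₁_self])
  · exact mem_states_of_mem_stmts₁ h (by simp [TM2.stmts₁, TM2.stmts₁_self])
  · split
    · exact mem_states_of_mem_stmts₁ h TM2.stmts₁_self
    · exact mem_states_of_mem_stmts₁ h (by simp [TM2.stmts₁, TM2.stmts₁_self])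
  · exact mem_states_of_mem_stmts₁ h TM2.stmts₁_self

theorem trans_mem [DecidableEq K] (hT : ∀ l ∈ T, TM2.SupportsStmt T (M l)) :
    ∀ s ∈ states M T, ∀ t r, trans M s t = some r → r.1 ∈ states M T
  | none, _, _, _, h => by simp [trans] at h
  | some (false, _, _), hs, none, _, h => Option.some.inj h ▸ markTrans_mem hT hs
  | some (false, _, _), hs, some _, _, h => Option.some.inj h ▸ hs
  | some (true, _, _), hs, _, _, h => Option.some.inj h ▸ searchTrans_mem hs _

end Support

variable [DecidableEq K] [Fintype σ]

/-- A queue machine that simulates a machine with several stacks. -/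
noncomputable def machine (M : Λ → TM2.Stmt (fun _ : K => Γ) Λ σ) (T : Finset Λ)
    (hT : ∀ l ∈ T, TM2.SupportsStmt T (M l)) (l₀ : Λ) (hl₀ : l₀ ∈ T) (v₀ : σ) :
    QueueMachine (State K Γ Λ σ) (Letter K Γ) where
  trans := trans M
  start := some (false, M l₀, v₀)
  states := states M T
  start_mem := mem_states_of_label hl₀ v₀
  trans_mem := trans_mem hT

variable {M : Λ → TM2.Stmt (fun _ : K => Γ) Λ σ} {T : Finset Λ}
  {hT : ∀ l ∈ T, TM2.SupportsStmt T (M l)} {l₀ : Λ} {hl₀ : l₀ ∈ T} {v₀ : σ}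

/-- Two letters must be written per step, so a token is copied together with a blank. Blanks belong
to no stack, hence the growth of the queue does no harm. -/
theorem reaches_rotate (q : TM2.Stmt (fun _ : K => Γ) Λ σ) (v : σ) (L R : List (Option (K × Γ))) :
    Reaches (machine M T hT l₀ hl₀ v₀).step (some (false, q, v), L.map some ++ none :: R.map some)
      (some (false, q, v), none :: (R ++ pad L).map some) := by
  induction L generalizing R with
  | nil => simpa [pad] using reaches_refl _ _
  | cons t L ih =>
    refine reaches_head (b := (some (false, q, v),
      L.map some ++ none :: (R ++ [t, none]).map some)) ?_ ?_
    · simp [QueueMachine.step, machine, trans]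
    · simpa [pad_cons] using ih (R ++ [t, none])

theorem reaches_peek (k : K) (f : σ → Option Γ → σ) (q : TM2.Stmt (fun _ : K => Γ) Λ σ) (v : σ)
    (L R : List (Option (K × Γ))) :
    ∃ L', Reaches (machine M T hT l₀ hl₀ v₀).step
        (some (true, .peek k f q, v), L.map some ++ none :: R.map some)
        (some (false, q, f v (stack k L).head?), none :: L'.map some) ∧
      ∀ k', stack k' L' = stack k' R ++ stack k' L := by
  induction L generalizing R with
  | nil =>
    -- Meeting the mark means that the stack is empty. The mark is put back at the rear, which costs
    -- one more full rotation.
    refine ⟨none :: pad R, reaches_head (b := (some (false, q, f v none),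
      R.map some ++ none :: [none].map some)) ?_ (reaches_rotate q _ R [none]), fun k' => ?_⟩
    · simp [QueueMachine.step, machine, trans, searchTrans]
    · simp [stack_none_cons, stack_pad, stack_nil]
  | cons t L ih =>
    rcases h : symbol k t with _ | γ
    · obtain ⟨L', h₁, h₂⟩ := ih (R ++ [t, none])
      refine ⟨L', reaches_head (b := (some (true, .peek k f q, v),
        L.map some ++ none :: (R ++ [t, none]).map some)) ?_ ?_, fun k' => ?_⟩
      · simp [QueueMachine.step, machine, trans, searchTrans, h]
      · simpa [stack_cons, h] using h₁
      · simp [h₂, stack_append, stack_cons, symbol_none, stack_nil]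
    · refine ⟨R ++ [t, none] ++ pad L, reaches_head
        (b := (some (false, q, f v (some γ)), L.map some ++ none :: (R ++ [t, none]).map some))
        ?_ ?_, fun k' => ?_⟩
      · simp [QueueMachine.step, machine, trans, searchTrans, h]
      · simpa [stack_cons, h] using reaches_rotate q (f v (some γ)) L (R ++ [t, none])
      · simp [stack_append, stack_cons, symbol_none, stack_pad]

theorem symbol_eq_none {k k' : K} (h : k' ≠ k) {t : Option (K × Γ)} {γ : Γ}
    (ht : symbol k t = some γ) : symbol k' t = none := by
  rcases t with _ | ⟨k'', γ'⟩
  · rfl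
  · simp only [symbol] at ht ⊢
    split_ifs at ht with h'
    subst h'
    exact if_neg h.symm

/-- The first token of stack `k` is overwritten by a blank. A token belongs to one stack only, so
the others are unchanged. -/
theorem reaches_pop (k : K) (f : σ → Option Γ → σ) (q : TM2.Stmt (fun _ : K => Γ) Λ σ) (v : σ)
    (L R : List (Option (K × Γ))) :
    ∃ L', Reaches (machine M T hT l₀ hl₀ v₀).step
        (some (true, .pop k f q, v), L.map some ++ none :: R.map some)
        (some (false, q, f v (stack k L).head?), none :: L'.map some) ∧
      ∀ k', stack k' L' =
        stack k' R ++ Function.update (fun k' => stack k' L) k (stack k L).tail k' := by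
  induction L generalizing R with
  | nil =>
    refine ⟨none :: pad R, reaches_head (b := (some (false, q, f v none),
      R.map some ++ none :: [none].map some)) ?_ (reaches_rotate q _ R [none]), fun k' => ?_⟩
    · simp [QueueMachine.step, machine, trans, searchTrans]
    · by_cases hk : k' = k
      · subst hk
        simp [stack_none_cons, stack_pad, stack_nil]
      · simp [hk, stack_none_cons, stack_pad, stack_nil]
  | cons t L ih =>
    rcases h : symbol k t with _ | γ
    · obtain ⟨L', h₁, h₂⟩ := ih (R ++ [t, none])
      refine ⟨L', reaches_head (b := (some (true, .pop k f q, v),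
        L.map some ++ none :: (R ++ [t, none]).map some)) ?_ ?_, fun k' => ?_⟩
      · simp [QueueMachine.step, machine, trans, searchTrans, h]
      · simpa [stack_cons, h] using h₁
      · rw [h₂]
        by_cases hk : k' = k
        · subst hk
          simp [stack_append, stack_cons, symbol_none, stack_nil, h]
        · simp [hk, stack_append, stack_cons, symbol_none, stack_nil]
    · refine ⟨R ++ [none, none] ++ pad L, reaches_head
        (b := (some (false, q, f v (some γ)), L.map some ++ none :: (R ++ [none, none]).map some))
        ?_ ?_, fun k' => ?_⟩
      · simp [QueueMachine.step, machine, trans, searchTrans, h]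
      · rw [stack_cons, h]
        exact reaches_rotate q (f v (some γ)) L (R ++ [none, none])
      · by_cases hk : k' = k
        · subst hk
          simp [stack_append, stack_cons, symbol_none, stack_pad, h]
        · simp [hk, stack_append, stack_cons, symbol_none, stack_pad,
            symbol_eq_none hk h]

/-- The relation between the configurations of the machine with stacks and those of the queue
machine. -/
def Represents (M : Λ → TM2.Stmt (fun _ : K => Γ) Λ σ) (c : TM2.Cfg (fun _ : K => Γ) Λ σ)
    (d : State K Γ Λ σ × List (Letter K Γ)) : Prop :=
  match c.l with
  | none => d.1 = none
  | some l => ∃ L : List (Option (K × Γ)), d = (some (false, M l, c.var), none :: L.map some) ∧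
      ∀ k, stack k L = c.stk k

theorem step_mark (q : TM2.Stmt (fun _ : K => Γ) Λ σ) (v : σ) (L : List (Option (K × Γ))) :
    ((markTrans M v q).1, L.map some ++ [(markTrans M v q).2.1, (markTrans M v q).2.2]) ∈
      (machine M T hT l₀ hl₀ v₀).step (some (false, q, v), none :: L.map some) := by
  simp [QueueMachine.step, machine, trans]

theorem exists_represents_stepAux (q : TM2.Stmt (fun _ : K => Γ) Λ σ) (v : σ)
    (st : K → List Γ) (L : List (Option (K × Γ))) (hL : ∀ k, stack k L = st k) :
    ∃ d, Represents M (TM2.stepAux q v st) d ∧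
      Reaches₁ (machine M T hT l₀ hl₀ v₀).step (some (false, q, v), none :: L.map some) d := by
  induction q generalizing v st L with
  | push k f q ih =>
    obtain ⟨d, h₁, h₂⟩ := ih v (Function.update st k (f v :: st k)) (some (k, f v) :: pad L) (by
      intro k'
      by_cases hk : k' = k
      · subst hk
        simp [stack_cons, stack_pad, hL, symbol]
      · simp [hk, Ne.symm hk, stack_cons, stack_pad, hL, symbol])
    -- The new token is written directly behind the mark, so after the rotation it precedes all
    -- others and is the top of its stack.
    exact ⟨d, h₁, .head (step_mark _ v L)
      (.trans_right (reaches_rotate q v L [some (k, f v)]) h₂)⟩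
  | peek k f q ih =>
    obtain ⟨L', h, h'⟩ := reaches_peek (M := M) (hT := hT) (hl₀ := hl₀) (v₀ := v₀) k f q v L [none]
    obtain ⟨d, h₁, h₂⟩ := ih (f v (st k).head?) st L' (by
      intro k'
      simp [h', stack_none_cons, stack_nil, hL])
    rw [hL] at h
    exact ⟨d, h₁, .head (step_mark _ v L) (.trans_right h h₂)⟩
  | pop k f q ih =>
    obtain ⟨L', h, h'⟩ := reaches_pop (M := M) (hT := hT) (hl₀ := hl₀) (v₀ := v₀) k f q v L [none]
    obtain ⟨d, h₁, h₂⟩ := ih (f v (st k).head?) (Function.update st k (st k).tail) L' (by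
      intro k'
      simp [h', stack_none_cons, stack_nil, hL])
    rw [hL] at h
    exact ⟨d, h₁, .head (step_mark _ v L) (.trans_right h h₂)⟩
  | load a q ih =>
    obtain ⟨d, h₁, h₂⟩ := ih (a v) st (none :: pad L) (by simp [stack_none_cons, stack_pad, hL])
    exact ⟨d, h₁, .head (step_mark _ v L) (.trans_right (reaches_rotate q (a v) L [none]) h₂)⟩
  | branch p q₁ q₂ ih₁ ih₂ =>
    obtain ⟨d, h₁, h₂⟩ : ∃ d, Represents M (TM2.stepAux (.branch p q₁ q₂) v st) d ∧
        Reaches₁ (machine M T hT l₀ hl₀ v₀).step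
          (some (false, cond (p v) q₁ q₂, v), none :: (none :: pad L).map some) d := by
      have hs : ∀ k, stack k (none :: pad L) = st k := by simp [stack_none_cons, stack_pad, hL]
      simp only [TM2.stepAux]
      cases p v
      · exact ih₂ v st _ hs
      · exact ih₁ v st _ hs
    exact ⟨d, h₁, .head (step_mark _ v L) (.trans_right (reaches_rotate _ v L [none]) h₂)⟩
  | goto l =>
    refine ⟨_, ⟨none :: pad L, rfl, by simp [stack_none_cons, stack_pad, hL]⟩,
      .head' (step_mark _ v L) (reaches_rotate _ v L [none])⟩
  | halt => exact ⟨(none, _), rfl, .single (step_mark _ v L)⟩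

/-- Configurations are compared only where a label is about to be executed or the machine has
stopped; the statements in between are handled by induction in `exists_represents_stepAux`. -/
theorem respects : Respects (TM2.step M) (machine M T hT l₀ hl₀ v₀).step (Represents M) := by
  rintro ⟨_ | l, v, st⟩ d hd
  · obtain ⟨s, _ | ⟨t, w⟩⟩ := d
    · rfl
    · obtain rfl : s = none := hd
      rfl
  · obtain ⟨L, rfl, hL⟩ := hd
    exact exists_represents_stepAux _ v st L hL

theorem machine_halts_iff (L : List (Option (K × Γ))) :
    (machine M T hT l₀ hl₀ v₀).Halts (none :: L.map some) ↔
      (eval (TM2.step M) ⟨some l₀, v₀, fun k => stack k L⟩).Dom :=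
  tr_eval_dom respects ⟨L, rfl, fun _ => rfl⟩

end StackSimulation

end OneDim

/-! ### Computability of the reduction. -/

namespace OneDim
open Formula

section Primrec

theorem primrec_toNat : Primrec Formula.toNat := Primrec.encode

theorem primrec_of_toNat {α : Type} [Primcodable α] {f : α → Formula}
    (h : Primrec fun a => (f a).toNat) : Primrec f := Primrec.encode_iff.1 h

theorem primrec_neg : Primrec Formula.neg :=
  primrec_of_toNat <| Primrec.nat_add.comp
    (Primrec.nat_mul.comp (Primrec.const 7) primrec_toNat) (Primrec.const 5)

theorem primrec_or : Primrec₂ Formula.or :=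
  primrec_of_toNat <| Primrec.nat_add.comp (Primrec.nat_mul.comp (Primrec.const 7)
    (Primrec₂.natPair.comp (primrec_toNat.comp Primrec.fst) (primrec_toNat.comp Primrec.snd)))
    (Primrec.const 4)

theorem primrec_and : Primrec₂ Formula.and :=
  primrec_neg.comp (primrec_or.comp (primrec_neg.comp Primrec.fst) (primrec_neg.comp Primrec.snd))

theorem primrec_ex (xs : List ℕ) : Primrec (Formula.ex xs) :=
  primrec_of_toNat <| Primrec.nat_add.comp (Primrec.nat_mul.comp (Primrec.const 7)
    (Primrec₂.natPair.comp (Primrec.const (Encodable.encode xs)) primrec_toNat)) (Primrec.const 6)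

/-- The formula `chain (a :: w)` as a function of `chain w`. -/
def chainCons (a : ℕ) (φ : Formula) : Formula :=
  and (.pred a 0)
    (.ex [1, 2] (and (.succ₁ 0 1) (and (.succ₁ 1 2) (.ex [0] (and (.eq 0 2) φ)))))

theorem primrec_chainCons (a : ℕ) : Primrec (chainCons a) :=
  primrec_and.comp (Primrec.const _) <| (primrec_ex _).comp <| primrec_and.comp (Primrec.const _) <|
    primrec_and.comp (Primrec.const _) <| (primrec_ex _).comp <|
      primrec_and.comp (Primrec.const _) Primrec.id

theorem chain_replicate_append (n a : ℕ) (w : List ℕ) :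
    chain (List.replicate n a ++ w) = (chainCons a)^[n] (chain w) := by
  induction n with
  | zero => rfl
  | succ n ih => rw [Function.iterate_succ_apply', ← ih]; rfl

theorem primrec_chain_replicate (a : ℕ) (w : List ℕ) :
    Primrec fun n => chain (List.replicate n a ++ w) :=
  (Primrec.nat_iterate Primrec.id (Primrec.const (chain w))
    ((primrec_chainCons a).comp Primrec.snd).to₂).of_eq fun n =>
      (chain_replicate_append n a w).symm

/-- Only the description of the input varies with `n`; the theory of the fixed machine is a
constant, so its noncomputable definition is harmless. -/
theorem QueueMachine.primrec_sentence {S A : Type} [Encodable A] [Fintype A] (Q : QueueMachine S A)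
    (forbid : Bool) (a b : A) (w : List A) :
    Primrec fun n => Q.sentence forbid (a :: (List.replicate n b ++ w)) := by
  have h := primrec_chain_replicate (QueueMachine.letter b) (w.map QueueMachine.letter)
  refine (primrec_and.comp ((primrec_ex [0]).comp (primrec_and.comp (Primrec.const (.pred 0 0))
    ((primrec_chainCons (QueueMachine.letter a)).comp h)))
    (Primrec.const (Q.theory forbid))).of_eq fun n => ?_
  simp only [QueueMachine.sentence, initRule, List.map_cons, List.map_append, List.map_replicate,
    chain, chainCons]

end Primrec

/-! ### A halting problem on powers of two. -/

section Halting

open Nat.Partrec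

theorem not_computablePred_halting :
    ¬ ComputablePred fun n : ℕ => (Code.eval (Denumerable.ofNat Code n) 0).Dom := fun h =>
  ComputablePred.halting_problem 0 <| ComputablePred.computable_of_manyOneReducible
    ⟨Encodable.encode, Computable.encode, fun c => by rw [Denumerable.ofNat_encode]⟩ h

theorem computable_two_pow : Computable fun n : ℕ => 2 ^ n :=
  (Primrec.nat_iterate Primrec.id (Primrec.const 1)
    (Primrec.nat_mul.comp (Primrec.const 2) Primrec.snd).to₂).to_comp.of_eq fun n => by
      simp

/-- A partial recursive function that is defined at `2 ^ n` if and only if the program with number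
`n` halts. -/
def haltingFun (x : ℕ) : Part ℕ :=
  (Nat.rfind fun n => Part.some (decide (2 ^ n = x))).bind fun n =>
    Code.eval (Denumerable.ofNat Code n) 0

theorem partrec_haltingFun : Partrec haltingFun := by
  have h : Computable₂ fun (x n : ℕ) => decide (2 ^ n = x) :=
    (Primrec.eq.decide.to_comp.comp (computable_two_pow.comp Computable.snd) Computable.fst).to₂
  exact (Partrec.rfind h.partrec₂).bind
    (Code.eval_part.comp ((Computable.ofNat Code).comp Computable.snd) (Computable.const 0)).to₂

theorem haltingFun_dom (n : ℕ) :
    (haltingFun (2 ^ n)).Dom ↔ (Code.eval (Denumerable.ofNat Code n) 0).Dom := by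
  have h : n ∈ Nat.rfind fun m => Part.some (decide (2 ^ m = 2 ^ n)) := by
    refine Nat.mem_rfind.2 ⟨by simp, fun {m} hm => ?_⟩
    simpa using hm.ne
  rw [haltingFun, Part.eq_some_iff.2 h, Part.bind_some]

end Halting

/-! ### A queue machine with undecidable halting problem. -/

section Undecidable

open Turing PartrecToTM2 ToPartrec

/-- Binary digits are listed with the least significant first. -/
theorem trNat_two_pow (n : ℕ) : trNat (2 ^ n) = List.replicate n Γ'.bit0 ++ [Γ'.bit1] := by
  have h : ∀ n : ℕ, ∃ p : PosNum, ((2 ^ n : ℕ) : Num) = .pos p ∧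
      trPosNum p = List.replicate n Γ'.bit0 ++ [Γ'.bit1] := by
    intro n
    induction n with
    | zero => exact ⟨.one, by simp; rfl, rfl⟩
    | succ n ih =>
      obtain ⟨p, hp, ih⟩ := ih
      refine ⟨.bit0 p, ?_, by rw [trPosNum, ih]; rfl⟩
      rw [pow_succ, mul_two, Nat.cast_add, hp, Num.bit0_of_bit0]
      rfl
  obtain ⟨p, hp, h⟩ := h n
  rw [trNat, hp, trNum, h]

theorem stack_map_main (k : K') (l : List Γ') :
    StackSimulation.stack k (l.map fun γ => some (K'.main, γ)) = K'.elim l [] [] [] k := by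
  have h : ∀ γ : Γ', StackSimulation.symbol k (some (K'.main, γ)) =
      if K'.main = k then some γ else none := fun _ => rfl
  rw [StackSimulation.stack, List.filterMap_map]
  cases k <;> simp [h]

theorem finite_K' : Finite K' :=
  Finite.of_surjective (fun i : Fin 4 => ![K'.main, K'.rev, K'.aux, K'.stack] i) fun k => by
    cases k
    exacts [⟨0, rfl⟩, ⟨1, rfl⟩, ⟨2, rfl⟩, ⟨3, rfl⟩]

theorem exists_queueMachine_not_computable :
    ∃ (S A : Type) (_ : Encodable A) (_ : Fintype A) (Q : QueueMachine S A) (a b : A) (w : List A),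
      ¬ ComputablePred fun n => Q.Halts (a :: (List.replicate n b ++ w)) := by
  obtain ⟨c, hc⟩ := Code.exists_code (Nat.Partrec'.part_iff₁.2 partrec_haltingFun)
  have := finite_K'
  have hs := tr_supports c Cont'.halt
  -- The queue starts with the mark, then the digits of `2 ^ n` as tokens of the main stack, then
  -- the terminator `Γ'.cons` of the number.
  refine ⟨_, StackSimulation.Letter K' Γ', Encodable.ofCountable _, Fintype.ofFinite _,
    StackSimulation.machine tr (codeSupp c Cont'.halt) hs.2 (trNormal c Cont'.halt) hs.1 none,
    none, some (some (K'.main, Γ'.bit0)),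
    [some (some (K'.main, Γ'.bit1)), some (some (K'.main, Γ'.cons))], fun h => ?_⟩
  refine not_computablePred_halting (h.of_eq fun n => ?_)
  have he := congrArg Part.Dom (PartrecToTM2.tr_eval c [2 ^ n])
  rw [hc ⟨[2 ^ n], rfl⟩] at he
  have hl := StackSimulation.machine_halts_iff (hT := hs.2) (hl₀ := hs.1) (v₀ := none)
    ((trList [2 ^ n]).map fun γ => some (K'.main, γ))
  simp only [stack_map_main] at hl
  have hv : List.Vector.head (⟨[2 ^ n], rfl⟩ : List.Vector ℕ 1) = 2 ^ n := rfl
  rw [← haltingFun_dom]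
  simpa [trNat_two_pow, hv] using hl.trans (iff_of_eq he)

end Undecidable

end OneDim

theorem mainTheorem6 :
    ¬ OneDim.F1SatDecidable OneDim.finiteStructures ∧
    ¬ OneDim.F1SatDecidable OneDim.omegaStructures ∧
    ¬ OneDim.F1SatDecidable OneDim.allStructures := by
  obtain ⟨S, A, _, _, Q, a, b, w, h⟩ := OneDim.exists_queueMachine_not_computable
  have hw : ∀ n, a :: (List.replicate n b ++ w) ≠ [] := fun n => List.cons_ne_nil _ _
  have key : ∀ (forbid : Bool) {K : OneDim.StructureClass}, OneDim.F1SatDecidable K →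
      ComputablePred fun n =>
        OneDim.SatisfiableOver K (Q.sentence forbid (a :: (List.replicate n b ++ w))) := by
    rintro forbid K ⟨D, hD, hK⟩
    exact ComputablePred.computable_of_manyOneReducible
      ⟨_, (Q.primrec_sentence forbid a b w).to_comp, fun n =>
        (hK _ (Q.isF1_sentence forbid _) (Q.isSentence_sentence forbid _)).symm⟩ hD
  refine ⟨fun hK => h ?_, fun hK => h ?_, fun hK => h ?_⟩
  · exact (key false hK).of_eq fun n => OneDim.QueueMachine.satisfiableOver_finite_iff (hw n)
  · exact (key true hK).not.of_eq fun n => by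
      rw [OneDim.QueueMachine.satisfiableOver_omega_iff (hw n), not_not]
  · exact (key true hK).not.of_eq fun n => by
      rw [OneDim.QueueMachine.satisfiableOver_all_iff (hw n), not_not]
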